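/- Let $n\ge 1$ and let $Z=(Z_1,\dots,Z_n)$ have i.i.d. $N(0,\sigma^2)$ coordinates, $\sigma>0$. An infinite constellation (IC) is a nonempty set $S\subset\mathbb R^n$ that has finitely many points in each cube $\mathrm{Cb}(a)=\{x:|x_i|<a/2\ \forall i\}$. Put $M(S,a)=|S\cap \mathrm{Cb}(a)|$, $\mathbb E_a[f]=\frac1{M(S,a)}\sum_{s\in S\cap \mathrm{Cb}(a)}f(s)$, let $\gamma(S)=\limsup_{a\to\infty}M(S,a)/a^n\in[0,\infty]$ be the density and, if $0<\gamma(S)<\infty$, let $\delta(S)=\frac1n\log\gamma(S)$. Let $W(s)=\{x:\|x-s\|\le\|x-t\|\ \forall t\in S\}$ be the Voronoi cell of $s\in S$, $P_e(s)=\Pr\{s+Z\notin W(s)\}$, and let $P_e(S)=\limsup_{a\to\infty}\mathbb E_a[P_e(s)]$ be the average error probability. Let $V_n$ be the volume of the unit ball. For $v\in[0,\infty]$ let $\mathrm{SPB}(v)=\Pr\{\|Z\|>(v/V_n)^{1/n}\}$ be the probability that $Z$ leaves the centred ball of volume $v$. An IC is regular if there is $r_0>0$ such that $W(s)$ lies in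 the open ball of radius $r_0$ about $s$ for all $s\in S$, and $M(S,a)/a^n\to\gamma(S)$ as $a\to\infty$; put $v(S)=\limsup_{a\to\infty}\mathbb E_a[|W(s)|]$, where $|\cdot|$ is volume. The conventions $1/0=\infty$, $1/\infty=0$ are used. Then: 1. For every IC $S$ (lattice or not) with density $\gamma=\gamma(S)$, $P_e(S)\ge \mathrm{SPB}(1/\gamma)$. If $0<\gamma<\infty$, then $\mathrm{SPB}(1/\gamma)=\Pr\{\|Z\|>r_{\mathrm{eff}}\}$, where $r_{\mathrm{eff}}=e^{-\delta(S)}V_n^{-1/n}$ is the radius of a ball of volume $1/\gamma$. 2. For every regular IC $S$, $\gamma(S)=1/v(S)$. 3. $\mathrm{SPB}$ is convex on $[0,\infty)$. 4. For every regular IC $S$, $P_e(S)\ge\mathrm{SPB}(v(S))=\mathrm{SPB}(1/\gamma(S))$. 5. For every IC $S$ with $0<\gamma(S)<\infty$ and every $\xi>0$ there is a regular IC $S'$ with $\gamma(S')\ge\gamma(S)/(1+\xi)$ and $P_e(S')\le(1+\xi)P_e(S)$. -/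

import Mathlib

open Set Filter Topology MeasureTheory ProbabilityTheory
open scoped NNReal ENNReal

namespace InfConst

noncomputable section

/-- The open hypercube `{x : ∀ i, |x i| < a / 2}` of edge length `a` centred at the origin. -/
def cube (n : ℕ) (a : ℝ) : Set (EuclideanSpace ℝ (Fin n)) :=
  {x | ∀ i, |x i| < a / 2}

/-- An infinite constellation: a nonempty set of points of which every cube contains only
finitely many. -/
def IsIC {n : ℕ} (S : Set (EuclideanSpace ℝ (Fin n))) : Prop :=
  S.Nonempty ∧ ∀ a : ℝ, (S ∩ cube n a).Finite

/-- `M(S, a)`, the number of points of `S` in the cube of edge length `a`. -/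
def numPoints {n : ℕ} (S : Set (EuclideanSpace ℝ (Fin n))) (a : ℝ) : ℝ≥0∞ :=
  ((S ∩ cube n a).encard : ℝ≥0∞)

/-- The density `γ(S) = limsup_{a → ∞} M(S, a) / a ^ n`. -/
def density {n : ℕ} (S : Set (EuclideanSpace ℝ (Fin n))) : ℝ≥0∞ :=
  limsup (fun a : ℝ => numPoints S a / ENNReal.ofReal a ^ n) atTop

/-- The normalized log density `δ = (1 / n) log γ`
(meaningful when the density is positive and finite). -/
def nld {n : ℕ} (S : Set (EuclideanSpace ℝ (Fin n))) : ℝ :=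
  1 / (n : ℝ) * Real.log (density S).toReal

/-- `𝔼_a[f(s)]`: the average of `f` over the points of `S` in the cube of edge length `a`. -/
def cubeAverage {n : ℕ} (S : Set (EuclideanSpace ℝ (Fin n))) (a : ℝ)
    (f : EuclideanSpace ℝ (Fin n) → ℝ≥0∞) : ℝ≥0∞ :=
  (∑' s : ↥(S ∩ cube n a), f s) / numPoints S a

/-- The (closed) Voronoi region of `s`. For an infinite constellation its boundary is a Lebesgue
null set, and replacing it by the open cell can only increase the error probability. -/
def voronoi {n : ℕ} (S : Set (EuclideanSpace ℝ (Fin n))) (s : EuclideanSpace ℝ (Fin n)) :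
    Set (EuclideanSpace ℝ (Fin n)) :=
  {x | ∀ t ∈ S, dist x s ≤ dist x t}

/-- The law of the noise `Z = (Z_1, …, Z_n)` with i.i.d. coordinates `Z_i ~ N(0, σ²)`. -/
def noise (n : ℕ) (σ : ℝ≥0) : Measure (EuclideanSpace ℝ (Fin n)) :=
  (Measure.pi fun _ : Fin n => gaussianReal 0 (σ ^ 2)).map (WithLp.toLp 2)

/-- The error probability `P_e(s) = Pr{s + Z ∉ W(s)}` of maximum likelihood decoding. -/
def errorProb {n : ℕ} (σ : ℝ≥0) (S : Set (EuclideanSpace ℝ (Fin n)))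
    (s : EuclideanSpace ℝ (Fin n)) : ℝ≥0∞ :=
  noise n σ {z | s + z ∉ voronoi S s}

/-- The average error probability `P_e(S) = limsup_{a → ∞} 𝔼_a[P_e(s)]`. -/
def avgErrorProb {n : ℕ} (σ : ℝ≥0) (S : Set (EuclideanSpace ℝ (Fin n))) : ℝ≥0∞ :=
  limsup (fun a : ℝ => cubeAverage S a (errorProb σ S)) atTop

/-- `V_n`, the volume of the unit ball of `ℝⁿ`. -/
def unitBallVol (n : ℕ) : ℝ≥0∞ :=
  volume (Metric.ball (0 : EuclideanSpace ℝ (Fin n)) 1)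

/-- The radius `(v / V_n) ^ (1 / n)` of a ball of volume `v` in `ℝⁿ`
(`0` for `v = 0` and `∞` for `v = ∞`, when `n ≥ 1`). -/
def ballRadius (n : ℕ) (v : ℝ≥0∞) : ℝ≥0∞ :=
  (v / unitBallVol n) ^ (1 / (n : ℝ))

/-- `SPB(v)`, the probability that the noise leaves a centred ball of volume `v`. -/
def SPB (n : ℕ) (σ : ℝ≥0) (v : ℝ≥0∞) : ℝ≥0∞ :=
  noise n σ {z | ballRadius n v < ‖z‖ₑ}

/-- The effective radius `r_eff = e ^ (-δ) V_n ^ (-1 / n)` at normalized log density `δ`. -/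
def effRadius (n : ℕ) (δ : ℝ) : ℝ :=
  Real.exp (-δ) * (unitBallVol n).toReal ^ (-1 / (n : ℝ))

/-- The sphere bound `P_e^{SB}(n, δ) = Pr{‖Z‖ > r_eff}`. -/
def sphereBound (n : ℕ) (σ : ℝ≥0) (δ : ℝ) : ℝ≥0∞ :=
  noise n σ {z | effRadius n δ < ‖z‖}

/-- Regular infinite constellations: the Voronoi cells are uniformly bounded, and the density
is a limit. -/
def IsRegular {n : ℕ} (S : Set (EuclideanSpace ℝ (Fin n))) : Prop :=
  IsIC S ∧
  (∃ r₀ : ℝ, 0 < r₀ ∧ ∀ s ∈ S, voronoi S s ⊆ Metric.ball s r₀) ∧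
  Tendsto (fun a : ℝ => numPoints S a / ENNReal.ofReal a ^ n) atTop (𝓝 (density S))

/-- The average Voronoi cell volume `v(S) = limsup_{a → ∞} 𝔼_a[|W(s)|]`. -/
def avgVoronoiVol {n : ℕ} (S : Set (EuclideanSpace ℝ (Fin n))) : ℝ≥0∞ :=
  limsup (fun a : ℝ => cubeAverage S a (fun s => volume (voronoi S s))) atTop

end

end InfConst

/-!
The density of the Gaussian noise decreases with the distance from the origin, so among all
functions `h` with `0 ≤ h ≤ 1` and a given integral, the indicator of a centred ball captures the
most noise (the bathtub principle). Applied to a weighted average `∑ w_i 𝟙_{D_i}`, this gives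
`SPB (∑ w_i |D_i|) ≤ ∑ w_i Pr{Z ∉ D_i}`. Taking centred balls for the `D_i`, this is the convexity
of `SPB`. Taking the recentred Voronoi cells of the points in a cube with equal weights, it is the
sphere bound: the cells truncated to radius `r` are almost disjoint and stay within `r` of the
cube, hence their average volume is essentially at most the inverse density, while truncation only
costs `Pr{‖Z‖ > r}`. If the cells are uniformly bounded, they also cover the cube up to a boundary
layer, and the average volume equals the inverse density.

To regularize, choose a large cube in which `S` is nearly as dense as `γ(S)` and has nearly at most
the average error `P_e(S)`, and repeat its points periodically, separating the copies by a guard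
band of width `2r`. Points of other copies can be decoded only if `‖Z‖ > r`, which is negligible
compared with `P_e(S) > 0`.
-/

namespace InfConst

section Measure

theorem lintegral_fintype_prod {ι : Type*} [Fintype ι] {X : ι → Type*}
    [∀ i, MeasurableSpace (X i)] (μ : ∀ i, Measure (X i)) [∀ i, SigmaFinite (μ i)]
    {f : ∀ i, X i → ℝ≥0∞} (hf : ∀ i, Measurable (f i)) :
    ∫⁻ x, ∏ i, f i (x i) ∂Measure.pi μ = ∏ i, ∫⁻ t, f i t ∂μ i := by
  classical
  have hmeas : Measurable fun x : ∀ i, X i => ∏ i, f i (x i) :=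
    Finset.measurable_prod _ fun i _ => (hf i).comp (measurable_pi_apply i)
  have hmarginal (s : Finset ι) (x : ∀ i, X i) :
      (∫⋯∫⁻_s, (fun x => ∏ i, f i (x i)) ∂μ) x =
        (∏ i ∈ s, ∫⁻ t, f i t ∂μ i) * ∏ i ∈ sᶜ, f i (x i) := by
    induction s using Finset.induction_on generalizing x with
    | empty => simp
    | insert a s ha ih =>
      have hupdate (t : X a) : ∏ i ∈ sᶜ, f i (Function.update x a t i) =
          f a t * ∏ i ∈ (insert a s)ᶜ, f i (x i) := by
        rw [← Finset.insert_compl_insert ha, Finset.prod_insert (by simp), Function.update_self]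
        congr 1
        refine Finset.prod_congr rfl fun i hi => ?_
        rw [Function.update_of_ne]
        rintro rfl
        simp at hi
      rw [lmarginal_insert _ hmeas ha]
      simp only [ih, hupdate]
      rw [lintegral_const_mul _ ((hf a).mul_const _), lintegral_mul_const _ (hf a),
        Finset.prod_insert ha]
      ring
  obtain hempty | ⟨⟨x⟩⟩ := isEmpty_or_nonempty (∀ i, X i)
  · obtain ⟨i, hi⟩ := isEmpty_pi.1 hempty
    simp [Finset.prod_eq_zero (Finset.mem_univ i), lintegral_of_isEmpty]
  · rw [lintegral_eq_lmarginal_univ x, hmarginal]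
    simp

theorem pi_withDensity {ι : Type*} [Fintype ι] {X : ι → Type*}
    [∀ i, MeasurableSpace (X i)] (μ : ∀ i, Measure (X i)) [∀ i, SigmaFinite (μ i)]
    {f : ∀ i, X i → ℝ≥0∞} (hf : ∀ i, Measurable (f i))
    [∀ i, SigmaFinite ((μ i).withDensity (f i))] :
    Measure.pi (fun i => (μ i).withDensity (f i)) =
      (Measure.pi μ).withDensity fun x => ∏ i, f i (x i) := by
  refine Measure.pi_eq fun s hs => ?_
  rw [withDensity_apply _ (MeasurableSet.univ_pi hs), Measure.restrict_pi_pi,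
    lintegral_fintype_prod _ hf]
  exact Finset.prod_congr rfl fun i _ => (withDensity_apply _ (hs i)).symm

/-- Bathtub principle. Pointwise, `g h + c 𝟙_B ≤ g 𝟙_B + c h`. -/
theorem lintegral_mul_le_setLIntegral {X : Type*} [MeasurableSpace X] {μ : Measure X}
    {g h : X → ℝ≥0∞} (hh : Measurable h) (hone : ∀ x, h x ≤ 1) {B : Set X}
    (hB : MeasurableSet B) {c : ℝ≥0∞} (hc : c ≠ ∞) (hin : ∀ x ∈ B, c ≤ g x)
    (hout : ∀ x ∉ B, g x ≤ c) (hfin : μ B ≠ ∞) (hint : ∫⁻ x, h x ∂μ ≤ μ B) :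
    ∫⁻ x, g x * h x ∂μ ≤ ∫⁻ x in B, g x ∂μ := by
  have hpt (x : X) :
      g x * h x + B.indicator (fun _ => c) x ≤ B.indicator g x + c * h x := by
    by_cases hx : x ∈ B
    · obtain ⟨k, hk⟩ := exists_add_of_le (hone x)
      simp only [indicator_of_mem hx]
      calc g x * h x + c = g x * h x + (c * h x + c * k) := by rw [← mul_add, ← hk, mul_one]
        _ ≤ g x * h x + (c * h x + g x * k) := by gcongr; exact hin x hx
        _ = g x * (h x + k) + c * h x := by ring
        _ = g x + c * h x := by rw [← hk, mul_one]
    · simp only [indicator_of_notMem hx, add_zero, zero_add]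
      gcongr
      exact hout x hx
  have hsum : ∫⁻ x, g x * h x ∂μ + c * μ B ≤ ∫⁻ x in B, g x ∂μ + c * μ B :=
    calc ∫⁻ x, g x * h x ∂μ + c * μ B
        = ∫⁻ x, (g x * h x + B.indicator (fun _ => c) x) ∂μ := by
          rw [lintegral_add_right _ (measurable_const.indicator hB), lintegral_indicator_const hB]
      _ ≤ ∫⁻ x, (B.indicator g x + c * h x) ∂μ := lintegral_mono hpt
      _ = ∫⁻ x in B, g x ∂μ + c * ∫⁻ x, h x ∂μ := by
          rw [lintegral_add_right _ (hh.const_mul c), lintegral_indicator hB,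
            lintegral_const_mul c hh]
      _ ≤ ∫⁻ x in B, g x ∂μ + c * μ B := by gcongr
  exact ENNReal.le_of_add_le_add_right (ENNReal.mul_ne_top hc hfin) hsum

theorem lintegral_tsum_mul_indicator {X ι : Type*} [Countable ι] [MeasurableSpace X]
    (μ : Measure X) (w : ι → ℝ≥0∞) {D : ι → Set X} (hD : ∀ i, MeasurableSet (D i)) :
    ∫⁻ x, ∑' i, w i * (D i).indicator 1 x ∂μ = ∑' i, w i * μ (D i) := by
  rw [lintegral_tsum fun i => ((measurable_one.indicator (hD i)).const_mul _).aemeasurable]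
  refine tsum_congr fun i => ?_
  rw [lintegral_const_mul _ (measurable_one.indicator (hD i)), lintegral_indicator_one (hD i)]

theorem tendsto_measure_compl_closedBall {X : Type*} [NormedAddCommGroup X] [ProperSpace X]
    [MeasurableSpace X] [BorelSpace X] (μ : Measure X) [IsFiniteMeasure μ] (x : X) :
    Tendsto (fun r : ℝ => μ (Metric.closedBall x r)ᶜ) atTop (𝓝 0) := by
  simpa using tendsto_measure_compl_closedBall_of_isTightMeasureSet
    (isTightMeasureSet_singleton (μ := μ)) x

theorem setOf_lt_enorm_eq_compl_closedBall {X : Type*} [SeminormedAddCommGroup X] {r : ℝ≥0∞}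
    (hr : r ≠ ∞) : {z : X | r < ‖z‖ₑ} = (Metric.closedBall 0 r.toReal)ᶜ := by
  ext z
  rw [mem_ofPred_eq, mem_compl_iff, mem_closedBall_zero_iff, not_le, ← ofReal_norm,
    ENNReal.lt_ofReal_iff_toReal_lt hr]

end Measure

section Noise

variable {n : ℕ} {σ : ℝ≥0}

/-- The value at distance `r` from the origin of the Lebesgue density of `noise n σ`. -/
noncomputable def noiseProfile (n : ℕ) (σ : ℝ≥0) (r : ℝ) : ℝ≥0∞ :=
  ENNReal.ofReal
    ((√(2 * Real.pi * (σ ^ 2 : ℝ≥0)))⁻¹ ^ n * Real.exp (-r ^ 2 / (2 * (σ ^ 2 : ℝ≥0))))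

theorem prod_gaussianPDF_eq_noiseProfile (x : EuclideanSpace ℝ (Fin n)) :
    ∏ i, gaussianPDF 0 (σ ^ 2) (x i) = noiseProfile n σ ‖x‖ := by
  simp only [gaussianPDF, gaussianPDFReal_def, noiseProfile]
  rw [← ENNReal.ofReal_prod_of_nonneg fun i _ => by positivity, Finset.prod_mul_distrib,
    ← Real.exp_sum, EuclideanSpace.norm_sq_eq]
  simp [neg_div, Finset.sum_div]

theorem antitoneOn_noiseProfile (n : ℕ) (σ : ℝ≥0) : AntitoneOn (noiseProfile n σ) (Ici 0) := by
  intro r (hr : 0 ≤ r) s _ hrs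
  unfold noiseProfile
  gcongr

theorem noiseProfile_pos (hσ : 0 < σ) (r : ℝ) : 0 < noiseProfile n σ r :=
  ENNReal.ofReal_pos.2 (by positivity)

theorem measurable_noiseProfile_norm (n : ℕ) (σ : ℝ≥0) :
    Measurable fun x : EuclideanSpace ℝ (Fin n) => noiseProfile n σ ‖x‖ := by
  unfold noiseProfile
  fun_prop

theorem noise_eq_withDensity (n : ℕ) (hσ : 0 < σ) :
    noise n σ = volume.withDensity fun x => noiseProfile n σ ‖x‖ := by
  have hgauss : gaussianReal 0 (σ ^ 2) = volume.withDensity (gaussianPDF 0 (σ ^ 2)) :=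
    gaussianReal_of_var_ne_zero 0 (by positivity)
  have : SigmaFinite (volume.withDensity (gaussianPDF 0 (σ ^ 2))) := hgauss ▸ inferInstance
  rw [noise, hgauss, pi_withDensity _ fun _ => measurable_gaussianPDF 0 _]
  ext s hs
  rw [Measure.map_apply (by fun_prop) hs, withDensity_apply _ hs,
    withDensity_apply _ (hs.preimage (by fun_prop)),
    ← (PiLp.volume_preserving_toLp (Fin n)).setLIntegral_comp_preimage hs
      (measurable_noiseProfile_norm n σ)]
  simp only [← prod_gaussianPDF_eq_noiseProfile, volume_pi]

instance isProbabilityMeasure_noise (n : ℕ) (σ : ℝ≥0) : IsProbabilityMeasure (noise n σ) :=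
  Measure.isProbabilityMeasure_map (by fun_prop)

theorem isOpenPosMeasure_noise (n : ℕ) (hσ : 0 < σ) : (noise n σ).IsOpenPosMeasure := by
  rw [noise_eq_withDensity n hσ]
  exact (withDensity_absolutelyContinuous' (measurable_noiseProfile_norm n σ).aemeasurable
    (ae_of_all _ fun x => (noiseProfile_pos hσ ‖x‖).ne')).isOpenPosMeasure

theorem tsum_mul_noise_le_noise_closedBall {ι : Type*} [Countable ι] (hσ : 0 < σ)
    {w : ι → ℝ≥0∞} (hw : ∑' i, w i ≤ 1) {D : ι → Set (EuclideanSpace ℝ (Fin n))}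
    (hD : ∀ i, MeasurableSet (D i)) {R : ℝ} (hR : 0 ≤ R)
    (hvol : ∑' i, w i * volume (D i) ≤
      volume (Metric.closedBall (0 : EuclideanSpace ℝ (Fin n)) R)) :
    ∑' i, w i * noise n σ (D i) ≤ noise n σ (Metric.closedBall 0 R) := by
  have hmeas : Measurable fun x => ∑' i, w i * (D i).indicator 1 x :=
    Measurable.tsum fun i => (measurable_one.indicator (hD i)).const_mul _
  have hone (x : EuclideanSpace ℝ (Fin n)) : ∑' i, w i * (D i).indicator 1 x ≤ 1 :=
    (ENNReal.tsum_le_tsum fun i =>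
      mul_le_of_le_one_right' (indicator_le_self' (by simp) x)).trans hw
  rw [← lintegral_tsum_mul_indicator _ w hD] at hvol ⊢
  rw [noise_eq_withDensity n hσ,
    lintegral_withDensity_eq_lintegral_mul _ (measurable_noiseProfile_norm n σ) hmeas,
    withDensity_apply _ Metric.isClosed_closedBall.measurableSet]
  refine lintegral_mul_le_setLIntegral hmeas hone Metric.isClosed_closedBall.measurableSet
    (c := noiseProfile n σ R) ENNReal.ofReal_ne_top (fun x hx => ?_) (fun x hx => ?_)
    measure_closedBall_lt_top.ne hvol
  · exact antitoneOn_noiseProfile n σ (norm_nonneg x) hR (mem_closedBall_zero_iff.1 hx)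
  · rw [mem_closedBall_zero_iff, not_le] at hx
    exact antitoneOn_noiseProfile n σ hR (norm_nonneg x) hx.le

end Noise

section SphereBound

variable {n : ℕ} {σ : ℝ≥0} {v : ℝ≥0∞}

theorem unitBallVol_ne_zero (n : ℕ) : unitBallVol n ≠ 0 :=
  (Metric.measure_ball_pos volume _ one_pos).ne'

theorem unitBallVol_ne_top (n : ℕ) : unitBallVol n ≠ ∞ := measure_ball_lt_top.ne

theorem ballRadius_ne_top (hv : v ≠ ∞) : ballRadius n v ≠ ∞ :=
  ENNReal.rpow_ne_top_of_nonneg (by positivity) (ENNReal.div_ne_top hv (unitBallVol_ne_zero n))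

theorem monotone_ballRadius (n : ℕ) : Monotone (ballRadius n) := fun _ _ h =>
  ENNReal.rpow_le_rpow (ENNReal.div_le_div_right h _) (by positivity)

theorem continuous_ballRadius (n : ℕ) : Continuous (ballRadius n) :=
  ENNReal.continuous_rpow_const.comp (ENNReal.continuous_div_const _ (unitBallVol_ne_zero n))

theorem volume_closedBall_ballRadius (hn : 0 < n) (hv : v ≠ ∞) :
    volume (Metric.closedBall (0 : EuclideanSpace ℝ (Fin n)) (ballRadius n v).toReal) = v := by
  rw [Measure.addHaar_closedBall _ _ ENNReal.toReal_nonneg, finrank_euclideanSpace_fin,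
    ENNReal.ofReal_pow ENNReal.toReal_nonneg, ENNReal.ofReal_toReal (ballRadius_ne_top hv),
    ballRadius, ← ENNReal.rpow_natCast, ← ENNReal.rpow_mul, one_div,
    inv_mul_cancel₀ (by positivity), ENNReal.rpow_one]
  exact ENNReal.div_mul_cancel (unitBallVol_ne_zero n) (unitBallVol_ne_top n)

theorem toReal_ballRadius_inv_density {S : Set (EuclideanSpace ℝ (Fin n))}
    (hγ : 0 < (density S).toReal) : (ballRadius n (density S)⁻¹).toReal = effRadius n (nld S) := by
  rw [ballRadius, ← ENNReal.toReal_rpow, ENNReal.toReal_div, ENNReal.toReal_inv, effRadius, nld,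
    Real.div_rpow (by positivity) ENNReal.toReal_nonneg, neg_div,
    Real.rpow_neg ENNReal.toReal_nonneg, ← div_eq_mul_inv, Real.inv_rpow hγ.le, Real.exp_neg,
    Real.rpow_def_of_pos hγ, mul_comm (1 / (n : ℝ))]

theorem antitone_SPB (n : ℕ) (σ : ℝ≥0) : Antitone (SPB n σ) := fun _ _ h =>
  measure_mono fun _ hz => (monotone_ballRadius n h).trans_lt hz

theorem SPB_ne_top (n : ℕ) (σ : ℝ≥0) (v : ℝ≥0∞) : SPB n σ v ≠ ∞ := measure_ne_top _ _

theorem SPB_top (hn : 0 < n) (σ : ℝ≥0) : SPB n σ ∞ = 0 := by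
  have : ballRadius n ∞ = ∞ := by
    rw [ballRadius, ENNReal.top_div_of_ne_top (unitBallVol_ne_top n)]
    exact ENNReal.top_rpow_of_pos (by positivity)
  simp [SPB, this]

theorem SPB_eq_noise_compl_closedBall (σ : ℝ≥0) (hv : v ≠ ∞) :
    SPB n σ v = noise n σ (Metric.closedBall 0 (ballRadius n v).toReal)ᶜ := by
  rw [SPB, setOf_lt_enorm_eq_compl_closedBall (ballRadius_ne_top hv)]

theorem SPB_pos (hn : 0 < n) (hσ : 0 < σ) (hv : v ≠ ∞) : 0 < SPB n σ v := by
  have := isOpenPosMeasure_noise n hσ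
  have : Nonempty (Fin n) := ⟨⟨0, hn⟩⟩
  obtain ⟨x, hx⟩ := NormedSpace.exists_lt_norm ℝ (EuclideanSpace ℝ (Fin n)) (ballRadius n v).toReal
  rw [SPB_eq_noise_compl_closedBall σ hv]
  exact Metric.isClosed_closedBall.isOpen_compl.measure_pos _ ⟨x, by simpa using hx⟩

theorem SPB_inv_density_eq_sphereBound (σ : ℝ≥0) {S : Set (EuclideanSpace ℝ (Fin n))}
    (h0 : 0 < density S) (ht : density S < ∞) :
    SPB n σ (density S)⁻¹ = sphereBound n σ (nld S) := by
  rw [SPB_eq_noise_compl_closedBall σ (ENNReal.inv_ne_top.2 h0.ne'),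
    toReal_ballRadius_inv_density (ENNReal.toReal_pos h0.ne' ht.ne), sphereBound]
  congr 1
  ext z
  simp

theorem continuousWithinAt_SPB_Ioi (n : ℕ) (σ : ℝ≥0) (v : ℝ≥0∞) :
    ContinuousWithinAt (SPB n σ) (Ioi v) v := by
  have hmeas (r : ℝ≥0∞) : MeasurableSet {z : EuclideanSpace ℝ (Fin n) | r < ‖z‖ₑ} :=
    measurableSet_lt measurable_const measurable_enorm
  refine tendsto_measure_of_tendsto_indicator_of_isFiniteMeasure _ _ (fun w => hmeas _)
    (fun z => ?_)
  by_cases hz : ballRadius n v < ‖z‖ₑ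
  · filter_upwards [((continuous_ballRadius n).tendsto v |>.mono_left
      nhdsWithin_le_nhds).eventually_lt_const hz] with w hw
    exact iff_of_true hw hz
  · filter_upwards [self_mem_nhdsWithin] with w hw
    exact iff_of_false (fun h => hz ((monotone_ballRadius n (le_of_lt hw)).trans_lt h)) hz

theorem SPB_tsum_mul_volume_le {ι : Type*} [Countable ι] (hn : 0 < n) (hσ : 0 < σ)
    {w : ι → ℝ≥0∞} (hw : ∑' i, w i = 1) {D : ι → Set (EuclideanSpace ℝ (Fin n))}
    (hD : ∀ i, MeasurableSet (D i)) :
    SPB n σ (∑' i, w i * volume (D i)) ≤ ∑' i, w i * noise n σ (D i)ᶜ := by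
  obtain hv | hv := eq_or_ne (∑' i, w i * volume (D i)) ∞
  · simp [hv, SPB_top hn]
  set B := Metric.closedBall (0 : EuclideanSpace ℝ (Fin n))
    (ballRadius n (∑' i, w i * volume (D i))).toReal
  have hball : ∑' i, w i * noise n σ (D i) ≤ noise n σ B :=
    tsum_mul_noise_le_noise_closedBall hσ hw.le hD ENNReal.toReal_nonneg
      (volume_closedBall_ballRadius hn hv).ge
  have htotal : ∑' i, w i * noise n σ (D i) + ∑' i, w i * noise n σ (D i)ᶜ = 1 := by
    simp only [← ENNReal.tsum_add, ← mul_add, prob_add_prob_compl (hD _), mul_one, hw]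
  rw [SPB_eq_noise_compl_closedBall σ hv, prob_compl_eq_one_sub
    Metric.isClosed_closedBall.measurableSet, tsub_le_iff_left, ← htotal]
  gcongr

theorem SPB_add_le (hn : 0 < n) (hσ : 0 < σ) {a b v w : ℝ≥0∞} (hab : a + b = 1) (hv : v ≠ ∞)
    (hw : w ≠ ∞) : SPB n σ (a * v + b * w) ≤ a * SPB n σ v + b * SPB n σ w := by
  set B : ℝ≥0∞ → Set (EuclideanSpace ℝ (Fin n)) := fun u =>
    Metric.closedBall 0 (ballRadius n u).toReal
  have hB (u : ℝ≥0∞) : MeasurableSet (B u) := Metric.isClosed_closedBall.measurableSet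
  have key := SPB_tsum_mul_volume_le hn hσ (w := fun i : Bool => cond i a b)
    (D := fun i => cond i (B v) (B w)) (by simp [tsum_fintype, hab]) (by simp [hB])
  simpa only [tsum_fintype, Fintype.sum_bool, cond_true, cond_false, B,
    volume_closedBall_ballRadius hn hv, volume_closedBall_ballRadius hn hw,
    ← SPB_eq_noise_compl_closedBall σ hv, ← SPB_eq_noise_compl_closedBall σ hw] using key

theorem convexOn_SPB (hn : 0 < n) (hσ : 0 < σ) :
    ConvexOn ℝ (Ici 0) fun v : ℝ => (SPB n σ (ENNReal.ofReal v)).toReal := by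
  refine ⟨convex_Ici 0, fun v hv w hw a b ha hb hab => ?_⟩
  have hfin (c u : ℝ) : ENNReal.ofReal c * SPB n σ (ENNReal.ofReal u) ≠ ∞ :=
    ENNReal.mul_ne_top ENNReal.ofReal_ne_top (SPB_ne_top n σ _)
  have key := ENNReal.toReal_mono (ENNReal.add_ne_top.2 ⟨hfin a v, hfin b w⟩) <|
    SPB_add_le hn hσ (a := ENNReal.ofReal a) (b := ENNReal.ofReal b)
    (by rw [← ENNReal.ofReal_add ha hb, hab, ENNReal.ofReal_one])
    (ENNReal.ofReal_ne_top (r := v)) (ENNReal.ofReal_ne_top (r := w))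
  rwa [← ENNReal.ofReal_mul ha, ← ENNReal.ofReal_mul hb,
    ← ENNReal.ofReal_add (mul_nonneg ha hv) (mul_nonneg hb hw),
    ENNReal.toReal_add (hfin a v) (hfin b w),
    ENNReal.toReal_mul, ENNReal.toReal_mul, ENNReal.toReal_ofReal ha,
    ENNReal.toReal_ofReal hb] at key

end SphereBound

section Cubes

variable {n : ℕ} {S : Set (EuclideanSpace ℝ (Fin n))} {a : ℝ}

theorem cube_eq_preimage_pi_Ioo (n : ℕ) (a : ℝ) :
    cube n a = WithLp.ofLp ⁻¹' (univ.pi fun _ : Fin n => Ioo (-(a / 2)) (a / 2)) := by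
  ext x
  simp [cube, abs_lt]

theorem volume_cube (n : ℕ) (a : ℝ) : volume (cube n a) = ENNReal.ofReal a ^ n := by
  rw [cube_eq_preimage_pi_Ioo, (PiLp.volume_preserving_ofLp (Fin n)).measure_preimage
    (MeasurableSet.univ_pi fun _ => measurableSet_Ioo).nullMeasurableSet, Real.volume_pi_Ioo]
  simp

theorem mem_cube_of_dist_le {r : ℝ} {x y : EuclideanSpace ℝ (Fin n)} (hx : x ∈ cube n a)
    (h : dist y x ≤ r) : y ∈ cube n (a + 2 * r) := fun i => by
  have hyx : |y i - x i| ≤ r := (PiLp.norm_apply_le (y - x) i).trans (by rwa [← dist_eq_norm])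
  calc |y i| = |(y i - x i) + x i| := by rw [sub_add_cancel]
    _ ≤ |y i - x i| + |x i| := abs_add_le _ _
    _ < (a + 2 * r) / 2 := by linarith [hx i]

theorem mem_cube_of_norm_lt {x : EuclideanSpace ℝ (Fin n)} (h : ‖x‖ < a / 2) : x ∈ cube n a :=
  fun i => (PiLp.norm_apply_le x i).trans_lt h

theorem IsIC.numPoints_ne_top (hS : IsIC S) (a : ℝ) : numPoints S a ≠ ∞ := by
  simpa [numPoints] using (hS.2 a).encard_lt_top.ne

theorem cubeAverage_le_add {f g : EuclideanSpace ℝ (Fin n) → ℝ≥0∞} {c : ℝ≥0∞}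
    (h : ∀ s ∈ S ∩ cube n a, f s ≤ g s + c) : cubeAverage S a f ≤ cubeAverage S a g + c :=
  calc cubeAverage S a f
      ≤ (∑' s : ↥(S ∩ cube n a), (g s + c)) / numPoints S a :=
        ENNReal.div_le_div_right
          (ENNReal.tsum_le_tsum (f := fun s : ↥(S ∩ cube n a) => f s) fun s => h s s.2) _
    _ = cubeAverage S a g + numPoints S a * c / numPoints S a := by
        rw [ENNReal.tsum_add, ENNReal.tsum_set_const, ENNReal.add_div, cubeAverage, numPoints]
    _ ≤ cubeAverage S a g + c := by
        gcongr
        exact ENNReal.div_le_of_le_mul (mul_comm _ _).le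

theorem avgErrorProb_le_one (σ : ℝ≥0) (S : Set (EuclideanSpace ℝ (Fin n))) :
    avgErrorProb σ S ≤ 1 := by
  refine limsup_le_of_le (by isBoundedDefault) (Eventually.of_forall fun a => ?_)
  refine (cubeAverage_le_add (g := 0) (c := 1) fun s _ => ?_).trans_eq (by simp [cubeAverage])
  simpa [errorProb] using prob_le_one

theorem ofReal_pow_div_ofReal_pow {L : ℝ} (hL : 0 < L) (x : ℝ) (n : ℕ) :
    ENNReal.ofReal x ^ n / ENNReal.ofReal L ^ n = ENNReal.ofReal (x / L) ^ n := by
  rw [ENNReal.ofReal_div_of_pos hL, div_eq_mul_inv, div_eq_mul_inv, mul_pow, ENNReal.inv_pow]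

theorem tendsto_ofReal_add_pow_div (n : ℕ) (c : ℝ) :
    Tendsto (fun a : ℝ => ENNReal.ofReal (a + c) ^ n / ENNReal.ofReal a ^ n) atTop (𝓝 1) := by
  have hlim : Tendsto (fun a : ℝ => 1 + c / a) atTop (𝓝 1) := by
    simpa using ((tendsto_id (α := ℝ)).const_div_atTop c).const_add 1
  have hpow := ENNReal.Tendsto.pow (n := n) (ENNReal.tendsto_ofReal hlim)
  rw [ENNReal.ofReal_one, one_pow] at hpow
  refine hpow.congr' ?_
  filter_upwards [eventually_gt_atTop 0] with a ha
  rw [ofReal_pow_div_ofReal_pow ha, add_div, div_self ha.ne']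

theorem frequently_mul_lt_numPoints {g : ℝ≥0∞} (hg : g < density S) (c : ℝ) :
    ∃ᶠ a in atTop, g * ENNReal.ofReal (a + c) ^ n < numPoints S a := by
  obtain ⟨g', hgg', hg'⟩ := exists_between hg
  have hfreq : ∃ᶠ a in atTop, g' < numPoints S a / ENNReal.ofReal a ^ n :=
    frequently_lt_of_lt_limsup (by isBoundedDefault) hg'
  have hlim : Tendsto (fun a : ℝ => g * (ENNReal.ofReal (a + c) ^ n / ENNReal.ofReal a ^ n))
      atTop (𝓝 g) := by
    simpa using ENNReal.Tendsto.const_mul (tendsto_ofReal_add_pow_div n c) (Or.inl one_ne_zero)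
  refine (hfreq.and_eventually ((hlim.eventually_lt_const hgg').and
    (eventually_gt_atTop 0))).mono ?_
  rintro a ⟨hfreq, hlt, ha⟩
  rw [← mul_div_assoc] at hlt
  exact (ENNReal.div_lt_div_iff_left (by simp [ha]) (by simp)).1 (hlt.trans hfreq)

theorem tendsto_ofReal_add_pow_div_numPoints
    (h : Tendsto (fun a : ℝ => numPoints S a / ENNReal.ofReal a ^ n) atTop (𝓝 (density S)))
    (c : ℝ) : Tendsto (fun a : ℝ => ENNReal.ofReal (a + c) ^ n / numPoints S a) atTop
      (𝓝 (density S)⁻¹) := by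
  have hmul := ENNReal.Tendsto.mul (tendsto_ofReal_add_pow_div n c) (Or.inl one_ne_zero)
    (tendsto_inv_iff.2 h) (Or.inr ENNReal.one_ne_top)
  rw [one_mul] at hmul
  refine hmul.congr' ?_
  filter_upwards [eventually_gt_atTop 0] with a ha
  have ha0 : ENNReal.ofReal a ^ n ≠ 0 := by simp [ha]
  have hat : ENNReal.ofReal a ^ n ≠ ∞ := by simp
  rw [ENNReal.inv_div (Or.inl hat) (Or.inl ha0), ← mul_div_assoc,
    ENNReal.div_mul_cancel ha0 hat]

end Cubes

section Voronoi

variable {n : ℕ} {σ : ℝ≥0} {S : Set (EuclideanSpace ℝ (Fin n))}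

theorem isClosed_voronoi (S : Set (EuclideanSpace ℝ (Fin n))) (s : EuclideanSpace ℝ (Fin n)) :
    IsClosed (voronoi S s) := by
  simp only [voronoi, ofPred_forall]
  exact isClosed_biInter fun t _ => isClosed_le (by fun_prop) (by fun_prop)

theorem volume_voronoi_inter_voronoi {s t : EuclideanSpace ℝ (Fin n)} (hs : s ∈ S) (ht : t ∈ S)
    (hst : s ≠ t) : volume (voronoi S s ∩ voronoi S t) = 0 := by
  refine measure_mono_null (t := (AffineSubspace.perpBisector s t : Set _)) ?_
    (Measure.addHaar_affineSubspace _ _ ?_)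
  · intro x hx
    exact AffineSubspace.mem_perpBisector_iff_dist_eq.2 (le_antisymm (hx.1 t ht) (hx.2 s hs))
  · rwa [Ne, AffineSubspace.perpBisector_eq_top]

theorem IsIC.exists_mem_voronoi (hS : IsIC S) (x : EuclideanSpace ℝ (Fin n)) :
    ∃ s ∈ S, x ∈ voronoi S s := by
  obtain ⟨s₀, hs₀⟩ := hS.1
  set a := 2 * (‖x‖ + dist x s₀ + 1)
  have hmem (t : EuclideanSpace ℝ (Fin n)) (ht : dist x t ≤ dist x s₀) : t ∈ cube n a := by
    refine mem_cube_of_norm_lt ?_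
    calc ‖t‖ ≤ ‖x‖ + dist x t := by
          rw [dist_comm, dist_eq_norm]
          exact norm_le_norm_add_norm_sub' t x
      _ < a / 2 := by simp only [a]; linarith
  obtain ⟨s, hs, hmin⟩ := exists_min_image _ (fun t => dist x t) (hS.2 a)
    ⟨s₀, hs₀, hmem s₀ le_rfl⟩
  refine ⟨s, hs.1, fun t ht => ?_⟩
  by_cases h : dist x t ≤ dist x s₀
  · exact hmin t ⟨ht, hmem t h⟩
  · exact (hmin s₀ ⟨hs₀, hmem s₀ le_rfl⟩).trans (not_le.1 h).le

theorem cubeAverage_volume_voronoi_inter_closedBall_le (hS : IsIC S) (a r : ℝ) :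
    cubeAverage S a (fun s => volume (voronoi S s ∩ Metric.closedBall s r)) ≤
      ENNReal.ofReal (a + 2 * r) ^ n / numPoints S a := by
  have : Finite ↥(S ∩ cube n a) := hS.2 a
  rw [← volume_cube]
  refine ENNReal.div_le_div_right ?_ _
  rw [← measure_iUnion₀]
  · exact measure_mono (iUnion_subset fun s x hx => mem_cube_of_dist_le s.2.2 hx.2)
  · exact fun s t hst => measure_mono_null (inter_subset_inter inter_subset_left inter_subset_left)
      (volume_voronoi_inter_voronoi s.2.1 t.2.1 (Subtype.coe_ne_coe.2 hst))
  · exact fun s =>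
      ((isClosed_voronoi S s).inter Metric.isClosed_closedBall).nullMeasurableSet

theorem le_cubeAverage_volume_voronoi (hS : IsIC S) {r : ℝ}
    (hW : ∀ s ∈ S, voronoi S s ⊆ Metric.closedBall s r) (a : ℝ) :
    ENNReal.ofReal (a + -(2 * r)) ^ n / numPoints S a ≤
      cubeAverage S a fun s => volume (voronoi S s) := by
  have : Finite ↥(S ∩ cube n a) := hS.2 a
  rw [← volume_cube]
  refine ENNReal.div_le_div_right ((measure_mono fun x hx => ?_).trans (measure_iUnion_le _)) _
  obtain ⟨s, hs, hxs⟩ := hS.exists_mem_voronoi x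
  have hsa : s ∈ cube n a := by
    simpa using mem_cube_of_dist_le hx (Metric.mem_closedBall'.1 (hW s hs hxs))
  exact mem_iUnion.2 ⟨⟨s, hs, hsa⟩, hxs⟩

theorem IsRegular.avgVoronoiVol_eq (hS : IsRegular S) : avgVoronoiVol S = (density S)⁻¹ := by
  obtain ⟨hIC, ⟨r, -, hball⟩, hlim⟩ := hS
  have hW (s) (hs : s ∈ S) : voronoi S s ⊆ Metric.closedBall s r :=
    (hball s hs).trans Metric.ball_subset_closedBall
  refine Tendsto.limsup_eq (tendsto_of_tendsto_of_tendsto_of_le_of_le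
    (tendsto_ofReal_add_pow_div_numPoints hlim (-(2 * r)))
    (tendsto_ofReal_add_pow_div_numPoints hlim (2 * r))
    (le_cubeAverage_volume_voronoi hIC hW) fun a => ?_)
  refine le_of_eq_of_le ?_ (cubeAverage_volume_voronoi_inter_closedBall_le hIC a r)
  simp only [cubeAverage]
  congr 1
  exact tsum_congr fun s => by rw [inter_eq_left.2 (hW s s.2.1)]

theorem SPB_cubeAverage_volume_le (hn : 0 < n) (hσ : 0 < σ) (hS : IsIC S) {a : ℝ}
    (h0 : numPoints S a ≠ 0) {D : EuclideanSpace ℝ (Fin n) → Set (EuclideanSpace ℝ (Fin n))}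
    (hD : ∀ s, MeasurableSet (D s)) :
    SPB n σ (cubeAverage S a fun s => volume (D s)) ≤
      cubeAverage S a fun s => noise n σ (D s)ᶜ := by
  have : Finite ↥(S ∩ cube n a) := hS.2 a
  have hw : ∑' _ : ↥(S ∩ cube n a), (numPoints S a)⁻¹ = 1 := by
    rw [ENNReal.tsum_set_const]
    exact ENNReal.mul_inv_cancel h0 (hS.numPoints_ne_top a)
  have key := SPB_tsum_mul_volume_le hn hσ hw fun s => hD s
  rwa [ENNReal.tsum_mul_left, ENNReal.tsum_mul_left, ← ENNReal.div_eq_inv_mul,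
    ← ENNReal.div_eq_inv_mul] at key

theorem SPB_div_numPoints_le (hn : 0 < n) (hσ : 0 < σ) (hS : IsIC S) {a : ℝ}
    (h0 : numPoints S a ≠ 0) (r : ℝ) :
    SPB n σ (ENNReal.ofReal (a + 2 * r) ^ n / numPoints S a) ≤
      cubeAverage S a (errorProb σ S) + noise n σ (Metric.closedBall 0 r)ᶜ := by
  set D : EuclideanSpace ℝ (Fin n) → Set (EuclideanSpace ℝ (Fin n)) := fun s =>
    (s + ·) ⁻¹' (voronoi S s ∩ Metric.closedBall s r)
  have hD (s) : MeasurableSet (D s) :=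
    ((isClosed_voronoi S s).inter Metric.isClosed_closedBall).measurableSet.preimage (by fun_prop)
  have hvol : cubeAverage S a (fun s => volume (D s)) ≤
      ENNReal.ofReal (a + 2 * r) ^ n / numPoints S a := by
    simpa only [D, measure_preimage_add] using
      cubeAverage_volume_voronoi_inter_closedBall_le hS a r
  have hsub (s) : (D s)ᶜ ⊆ {z | s + z ∉ voronoi S s} ∪ (Metric.closedBall 0 r)ᶜ := by
    intro z hz
    simpa [D, Classical.or_iff_not_imp_left] using hz
  exact (antitone_SPB n σ hvol).trans <| (SPB_cubeAverage_volume_le hn hσ hS h0 hD).trans <|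
    cubeAverage_le_add fun s _ => (measure_mono (hsub s)).trans (measure_union_le _ _)

theorem SPB_inv_le_avgErrorProb_add (hn : 0 < n) (hσ : 0 < σ) (hS : IsIC S) {g : ℝ≥0∞}
    (hg : g < density S) (r : ℝ) :
    SPB n σ g⁻¹ ≤ avgErrorProb σ S + noise n σ (Metric.closedBall 0 r)ᶜ := by
  rw [← tsub_le_iff_right]
  refine le_limsup_of_frequently_le
    ((frequently_mul_lt_numPoints hg (2 * r)).mono fun a ha => ?_) (by isBoundedDefault)
  rw [tsub_le_iff_right]
  refine (antitone_SPB n σ ?_).trans (SPB_div_numPoints_le hn hσ hS ha.ne_bot r)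
  rw [ENNReal.div_le_iff ha.ne_bot (hS.numPoints_ne_top a), ← ENNReal.div_eq_inv_mul,
    ENNReal.le_div_iff_mul_le (.inr ha.ne_bot) (.inr (hS.numPoints_ne_top a)), mul_comm]
  exact ha.le

theorem SPB_inv_density_le_avgErrorProb (hn : 0 < n) (hσ : 0 < σ) (hS : IsIC S) :
    SPB n σ (density S)⁻¹ ≤ avgErrorProb σ S := by
  obtain hγ | hγ := eq_or_ne (density S) 0
  · simp [hγ, SPB_top hn]
  have hle {w : ℝ≥0∞} (hw : (density S)⁻¹ < w) : SPB n σ w ≤ avgErrorProb σ S := by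
    have hlim := (tendsto_measure_compl_closedBall (noise n σ) 0).const_add (avgErrorProb σ S)
    rw [add_zero] at hlim
    refine ge_of_tendsto' hlim fun r => ?_
    simpa using SPB_inv_le_avgErrorProb_add hn hσ hS (ENNReal.inv_lt_iff_inv_lt.1 hw) r
  have : (𝓝[>] (density S)⁻¹).NeBot :=
    nhdsGT_neBot_of_exists_gt ⟨∞, (ENNReal.inv_ne_top.2 hγ).lt_top⟩
  exact le_of_tendsto (continuousWithinAt_SPB_Ioi n σ _)
    (eventually_nhdsWithin_of_forall fun w hw => hle hw)

end Voronoi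

section Periodization

variable {n : ℕ} {F : Set (EuclideanSpace ℝ (Fin n))} {L : ℝ}

/-- The additive map `k ↦ L k` from `ℤⁿ` to `ℝⁿ`, whose range is the lattice `L ℤⁿ`. -/
noncomputable def latticeVector (L : ℝ) : (Fin n → ℤ) →+ EuclideanSpace ℝ (Fin n) :=
  AddMonoidHom.mk' (fun k => WithLp.toLp 2 fun i => L * k i) fun k l => by
    ext i
    simp [mul_add]

@[simp]
theorem latticeVector_apply (L : ℝ) (k : Fin n → ℤ) (i : Fin n) :
    latticeVector L k i = L * k i := rfl

/-- The union of the translates of `F` by the lattice `L ℤⁿ`. -/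
def periodization (L : ℝ) (F : Set (EuclideanSpace ℝ (Fin n))) :
    Set (EuclideanSpace ℝ (Fin n)) :=
  range fun p : F × (Fin n → ℤ) => (p.1 : EuclideanSpace ℝ (Fin n)) + latticeVector L p.2

theorem add_latticeVector_mem_periodization {f : EuclideanSpace ℝ (Fin n)} (hf : f ∈ F)
    (k : Fin n → ℤ) : f + latticeVector L k ∈ periodization L F :=
  ⟨(⟨f, hf⟩, k), rfl⟩

theorem add_latticeVector_mem_periodization_iff {x : EuclideanSpace ℝ (Fin n)} (k : Fin n → ℤ) :
    x + latticeVector L k ∈ periodization L F ↔ x ∈ periodization L F := by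
  constructor
  · rintro ⟨⟨f, l⟩, hx⟩
    refine ⟨(f, l - k), ?_⟩
    simpa only [map_sub, ← add_sub_assoc, sub_eq_iff_eq_add] using hx
  · rintro ⟨⟨f, l⟩, rfl⟩
    exact ⟨(f, l + k), by simp [add_assoc]⟩

theorem sub_lt_dist_add_latticeVector {a : ℝ} (hL : 0 ≤ L) {f f' : EuclideanSpace ℝ (Fin n)}
    (hf : f ∈ cube n a) (hf' : f' ∈ cube n a) {k k' : Fin n → ℤ} (hk : k ≠ k') :
    L - a < dist (f + latticeVector L k) (f' + latticeVector L k') := by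
  obtain ⟨i, hi⟩ := Function.ne_iff.1 hk
  have hone : (1 : ℝ) ≤ |(k i - k' i : ℝ)| := by
    exact_mod_cast Int.one_le_abs (sub_ne_zero.2 hi)
  have hcube : |f' i - f i| < a := by
    linarith [abs_sub (f' i) (f i), hf i, hf' i]
  calc L - a < L * |(k i - k' i : ℝ)| - |f' i - f i| := by nlinarith
    _ = |L * (k i - k' i)| - |f' i - f i| := by rw [abs_mul, abs_of_nonneg hL]
    _ ≤ |L * (k i - k' i) - (f' i - f i)| := abs_sub_abs_le_abs_sub _ _
    _ = ‖(f + latticeVector L k - (f' + latticeVector L k')) i‖ := by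
        rw [Real.norm_eq_abs]
        congr 1
        simp only [PiLp.sub_apply, PiLp.add_apply, latticeVector_apply]
        ring
    _ ≤ dist (f + latticeVector L k) (f' + latticeVector L k') := by
        rw [dist_eq_norm]
        exact PiLp.norm_apply_le _ i

theorem injective_add_latticeVector (hL : 0 ≤ L) (hF : F ⊆ cube n L) :
    Function.Injective fun p : F × (Fin n → ℤ) =>
      (p.1 : EuclideanSpace ℝ (Fin n)) + latticeVector L p.2 := by
  rintro ⟨f, k⟩ ⟨f', k'⟩ (h : (f : EuclideanSpace ℝ (Fin n)) + _ = f' + _)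
  obtain rfl : k = k' := by
    by_contra hk
    have hdist := sub_lt_dist_add_latticeVector hL (hF f.2) (hF f'.2) hk
    rw [h, dist_self, sub_self] at hdist
    exact hdist.false
  exact Prod.ext (Subtype.ext (add_right_cancel h)) rfl

/-- The integer vectors `k` for which `f + L k` lies in the cube of edge length `A`. -/
noncomputable def shiftsInCube (L A : ℝ) (f : EuclideanSpace ℝ (Fin n)) : Finset (Fin n → ℤ) :=
  Fintype.piFinset fun i => Finset.Ioo ⌊(-(A / 2) - f i) / L⌋ ⌈(A / 2 - f i) / L⌉

theorem mem_shiftsInCube (hL : 0 < L) {A : ℝ} {f : EuclideanSpace ℝ (Fin n)} {k : Fin n → ℤ} :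
    k ∈ shiftsInCube L A f ↔ f + latticeVector L k ∈ cube n A := by
  simp only [shiftsInCube, Fintype.mem_piFinset, Finset.mem_Ioo, Int.floor_lt, Int.lt_ceil,
    div_lt_iff₀ hL, lt_div_iff₀ hL, sub_lt_iff_lt_add', lt_sub_iff_add_lt', cube, mem_ofPred_eq,
    PiLp.add_apply, latticeVector_apply, abs_lt, mul_comm L]

theorem abs_card_Ioo_floor_ceil_sub_le {x y : ℝ} (h : x ≤ y) :
    |((Finset.Ioo ⌊x⌋ ⌈y⌉).card : ℝ) - (y - x)| ≤ 1 := by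
  have hcard : ((Finset.Ioo ⌊x⌋ ⌈y⌉).card : ℝ) = max (⌈y⌉ - ⌊x⌋ - 1 : ℝ) 0 := by
    rw [Int.card_Ioo, ← Int.cast_natCast, Int.ofNat_toNat]
    push_cast
    rfl
  rw [hcard, abs_le]
  refine ⟨?_, ?_⟩
  · linarith [le_max_left (⌈y⌉ - ⌊x⌋ - 1 : ℝ) 0, Int.floor_le x, Int.le_ceil y]
  · have hle : max (⌈y⌉ - ⌊x⌋ - 1 : ℝ) 0 ≤ y - x + 1 :=
      max_le (by linarith [Int.lt_floor_add_one x, Int.ceil_lt_add_one y]) (by linarith)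
    linarith

theorem tendsto_card_Ioo_floor_ceil_div (hL : 0 < L) (t : ℝ) :
    Tendsto (fun A : ℝ => ((Finset.Ioo ⌊(-(A / 2) - t) / L⌋ ⌈(A / 2 - t) / L⌉).card : ℝ) / A)
      atTop (𝓝 L⁻¹) := by
  rw [← tendsto_sub_nhds_zero_iff]
  refine squeeze_zero_norm' ?_ tendsto_inv_atTop_zero
  filter_upwards [eventually_gt_atTop 0] with A hA
  have hle : (-(A / 2) - t) / L ≤ (A / 2 - t) / L := by gcongr; linarith
  have hlen : (A / 2 - t) / L - (-(A / 2) - t) / L = A * L⁻¹ := by ring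
  have hcount := abs_card_Ioo_floor_ceil_sub_le hle
  rw [hlen] at hcount
  rw [Real.norm_eq_abs, div_sub' hA.ne', abs_div, abs_of_pos hA, inv_eq_one_div A]
  gcongr

theorem tendsto_card_shiftsInCube_div (hL : 0 < L) (f : EuclideanSpace ℝ (Fin n)) :
    Tendsto (fun A : ℝ => ((shiftsInCube L A f).card : ℝ≥0∞) / ENNReal.ofReal A ^ n) atTop
      (𝓝 (ENNReal.ofReal L ^ n)⁻¹) := by
  have hlim := ENNReal.tendsto_finsetProd_of_ne_top (s := (Finset.univ : Finset (Fin n)))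
    (fun i _ => ENNReal.tendsto_ofReal (tendsto_card_Ioo_floor_ceil_div hL (f i)))
    fun i _ => ENNReal.ofReal_ne_top
  rw [Finset.prod_const, Finset.card_fin, ENNReal.ofReal_inv_of_pos hL, ← ENNReal.inv_pow] at hlim
  refine hlim.congr' ?_
  filter_upwards [eventually_gt_atTop 0] with A hA
  simp only [ENNReal.ofReal_div_of_pos hA, ENNReal.ofReal_natCast, shiftsInCube,
    Fintype.card_piFinset, Nat.cast_prod]
  simp only [div_eq_mul_inv _ (ENNReal.ofReal A), div_eq_mul_inv _ (ENNReal.ofReal A ^ n),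
    Finset.prod_mul_distrib, Finset.prod_const, Finset.card_fin, ENNReal.inv_pow]

theorem tsum_periodization_inter_cube (hL : 0 < L) (hF : F ⊆ cube n L)
    {g : EuclideanSpace ℝ (Fin n) → ℝ≥0∞} (hg : ∀ f k, g (f + latticeVector L k) = g f) (A : ℝ) :
    ∑' s : ↥(periodization L F ∩ cube n A), g s =
      ∑' f : F, ((shiftsInCube L A (f : EuclideanSpace ℝ (Fin n))).card : ℝ≥0∞) * g f := by
  have hinner (f : EuclideanSpace ℝ (Fin n)) :
      ∑' k, (cube n A).indicator g (f + latticeVector L k) = (shiftsInCube L A f).card * g f := by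
    have hindicator (k : Fin n → ℤ) : (cube n A).indicator g (f + latticeVector L k) =
        (shiftsInCube L A f : Set (Fin n → ℤ)).indicator (fun _ => g f) k := by
      simp only [indicator, ← mem_shiftsInCube hL, Finset.mem_coe, hg]
    rw [tsum_congr hindicator, ← tsum_subtype, ENNReal.tsum_set_const,
      encard_coe_eq_coe_finsetCard, ENat.toENNReal_coe]
  calc ∑' s : ↥(periodization L F ∩ cube n A), g s
      = ∑' s : ↥(periodization L F), (cube n A).indicator g s := by
        rw [tsum_subtype (periodization L F ∩ cube n A) g, tsum_subtype (periodization L F),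
          indicator_indicator]
    _ = ∑' f : F, ∑' k, (cube n A).indicator g (↑f + latticeVector L k) := by
        rw [periodization, tsum_range _ (injective_add_latticeVector hL.le hF)]
        exact ENNReal.tsum_prod
          (f := fun (f : F) k => (cube n A).indicator g (f.1 + latticeVector L k))
    _ = _ := tsum_congr fun f => hinner f

theorem tendsto_tsum_periodization_div (hL : 0 < L) (hfin : F.Finite) (hF : F ⊆ cube n L)
    {g : EuclideanSpace ℝ (Fin n) → ℝ≥0∞} (hg : ∀ f k, g (f + latticeVector L k) = g f) :
    Tendsto (fun A : ℝ =>
      (∑' s : ↥(periodization L F ∩ cube n A), g s) / ENNReal.ofReal A ^ n) atTop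
      (𝓝 ((∑' f : F, g f) / ENNReal.ofReal L ^ n)) := by
  have := hfin.fintype
  have hsum (A : ℝ) :
      (∑' s : ↥(periodization L F ∩ cube n A), g s) / ENNReal.ofReal A ^ n =
        ∑ f : F, ((shiftsInCube L A (f : EuclideanSpace ℝ (Fin n))).card : ℝ≥0∞) /
          ENNReal.ofReal A ^ n * g f := by
    simp only [tsum_periodization_inter_cube hL hF hg, tsum_fintype, div_eq_mul_inv,
      Finset.sum_mul, mul_right_comm]
  have hlim : (ENNReal.ofReal L ^ n)⁻¹ ≠ 0 := by simp
  simp only [hsum]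
  rw [tsum_fintype, ENNReal.div_eq_inv_mul, Finset.mul_sum]
  exact tendsto_finsetSum _ fun f _ => ENNReal.Tendsto.mul_const
    (tendsto_card_shiftsInCube_div hL (f : EuclideanSpace ℝ (Fin n))) (Or.inl hlim)

theorem tendsto_numPoints_periodization_div (hL : 0 < L) (hfin : F.Finite) (hF : F ⊆ cube n L) :
    Tendsto (fun A : ℝ => numPoints (periodization L F) A / ENNReal.ofReal A ^ n) atTop
      (𝓝 (F.encard / ENNReal.ofReal L ^ n)) := by
  simpa only [numPoints, ← ENNReal.tsum_set_one] using
    tendsto_tsum_periodization_div hL hfin hF (g := fun _ => 1) fun _ _ => rfl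

theorem density_periodization (hL : 0 < L) (hfin : F.Finite) (hF : F ⊆ cube n L) :
    density (periodization L F) = F.encard / ENNReal.ofReal L ^ n :=
  (tendsto_numPoints_periodization_div hL hfin hF).limsup_eq

theorem tendsto_cubeAverage_periodization (hL : 0 < L) (hfin : F.Finite) (hne : F.Nonempty)
    (hF : F ⊆ cube n L) {g : EuclideanSpace ℝ (Fin n) → ℝ≥0∞}
    (hg : ∀ f k, g (f + latticeVector L k) = g f) :
    Tendsto (fun A : ℝ => cubeAverage (periodization L F) A g) atTop
      (𝓝 ((∑' f : F, g f) / F.encard)) := by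
  have hL0 : ENNReal.ofReal L ^ n ≠ 0 := by simp [hL]
  have hLt : ENNReal.ofReal L ^ n ≠ ∞ := by simp
  have h0 : (F.encard / ENNReal.ofReal L ^ n : ℝ≥0∞) ≠ 0 := by simp [hne.ne_empty]
  have ht : (F.encard / ENNReal.ofReal L ^ n : ℝ≥0∞) ≠ ∞ :=
    ENNReal.div_ne_top (by simpa using hfin) hL0
  have hcancel {x y z : ℝ≥0∞} (hz0 : z ≠ 0) (hzt : z ≠ ∞) : x / z / (y / z) = x / y :=
    ENNReal.mul_div_mul_right x y (ENNReal.inv_ne_zero.2 hzt) (ENNReal.inv_ne_top.2 hz0)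
  have hlim := ENNReal.Tendsto.div (tendsto_tsum_periodization_div hL hfin hF hg) (Or.inr h0)
    (tendsto_numPoints_periodization_div hL hfin hF) (Or.inl ht)
  rw [hcancel hL0 hLt] at hlim
  refine hlim.congr' ?_
  filter_upwards [eventually_gt_atTop 0] with A hA
  exact hcancel (by simp [hA]) (by simp)

theorem finite_periodization_inter_cube (hL : 0 < L) (hfin : F.Finite) (A : ℝ) :
    (periodization L F ∩ cube n A).Finite := by
  refine (hfin.biUnion fun f _ => (shiftsInCube L A f).finite_toSet.image
    fun k => f + latticeVector L k).subset ?_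
  rintro _ ⟨⟨⟨f, k⟩, rfl⟩, hA⟩
  exact mem_iUnion₂.2 ⟨f, f.2, k, (mem_shiftsInCube hL).2 hA, rfl⟩

theorem voronoi_periodization_subset_ball (hL : 0 < L) (hne : F.Nonempty)
    (s : EuclideanSpace ℝ (Fin n)) :
    voronoi (periodization L F) s ⊆ Metric.ball s (√(n * L ^ 2) + 1) := by
  obtain ⟨f, hf⟩ := hne
  intro x hx
  set k : Fin n → ℤ := fun i => ⌊(x i - f i) / L⌋
  have hcoord (i : Fin n) : dist (x i) ((f + latticeVector L k) i) ^ 2 ≤ L ^ 2 := by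
    rw [Real.dist_eq, sq_abs, PiLp.add_apply, latticeVector_apply]
    have hfloor := (le_div_iff₀ hL).1 (Int.floor_le ((x i - f i) / L))
    have hlt := (div_lt_iff₀ hL).1 (Int.lt_floor_add_one ((x i - f i) / L))
    exact pow_le_pow_left₀ (by linarith) (by linarith) 2
  calc dist x s ≤ dist x (f + latticeVector L k) :=
        hx _ (add_latticeVector_mem_periodization hf k)
    _ = √(∑ i, dist (x i) ((f + latticeVector L k) i) ^ 2) := EuclideanSpace.dist_eq _ _
    _ ≤ √(n * L ^ 2) :=
        Real.sqrt_le_sqrt ((Finset.sum_le_sum fun i _ => hcoord i).trans_eq (by simp))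
    _ < √(n * L ^ 2) + 1 := lt_add_one _

theorem isRegular_periodization (hL : 0 < L) (hfin : F.Finite) (hne : F.Nonempty)
    (hF : F ⊆ cube n L) : IsRegular (periodization L F) := by
  refine ⟨⟨?_, finite_periodization_inter_cube hL hfin⟩,
    ⟨_, by positivity, fun s _ => voronoi_periodization_subset_ball hL hne s⟩, ?_⟩
  · exact hne.imp fun f hf => by simpa using add_latticeVector_mem_periodization hf 0
  · rw [density_periodization hL hfin hF]
    exact tendsto_numPoints_periodization_div hL hfin hF

theorem errorProb_periodization_add_latticeVector (σ : ℝ≥0) (L : ℝ)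
    (F : Set (EuclideanSpace ℝ (Fin n))) (s : EuclideanSpace ℝ (Fin n)) (k : Fin n → ℤ) :
    errorProb σ (periodization L F) (s + latticeVector L k) =
      errorProb σ (periodization L F) s := by
  have hvoronoi (z : EuclideanSpace ℝ (Fin n)) :
      s + latticeVector L k + z ∈ voronoi (periodization L F) (s + latticeVector L k) ↔
        s + z ∈ voronoi (periodization L F) s := by
    simp only [voronoi, mem_ofPred_eq]
    rw [← (Equiv.addRight (latticeVector L k)).forall_congr_right]
    simp only [Equiv.coe_addRight, add_latticeVector_mem_periodization_iff, add_right_comm s,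
      dist_add_right]
  simp only [errorProb, hvoronoi]

theorem avgErrorProb_periodization (σ : ℝ≥0) (hL : 0 < L) (hfin : F.Finite) (hne : F.Nonempty)
    (hF : F ⊆ cube n L) : avgErrorProb σ (periodization L F) =
      (∑' f : F, errorProb σ (periodization L F) f) / F.encard :=
  (tendsto_cubeAverage_periodization hL hfin hne hF
    (errorProb_periodization_add_latticeVector σ L F)).limsup_eq

theorem errorProb_periodization_le (σ : ℝ≥0) {S : Set (EuclideanSpace ℝ (Fin n))} {a : ℝ}
    (hL : 0 ≤ L) (hFS : F ⊆ S) (hF : F ⊆ cube n a) {f : EuclideanSpace ℝ (Fin n)} (hf : f ∈ F) :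
    errorProb σ (periodization L F) f ≤
      errorProb σ S f + noise n σ (Metric.closedBall 0 ((L - a) / 2))ᶜ := by
  suffices hsub : {z | f + z ∉ voronoi (periodization L F) f} ⊆
      {z | f + z ∉ voronoi S f} ∪ (Metric.closedBall 0 ((L - a) / 2))ᶜ from
    (measure_mono hsub).trans (measure_union_le _ _)
  intro z hz
  contrapose! hz
  simp only [mem_union, mem_ofPred_eq, mem_compl_iff, not_or, not_not,
    mem_closedBall_zero_iff] at hz ⊢
  obtain ⟨hvor, hnorm⟩ := hz
  rintro _ ⟨⟨f', k⟩, rfl⟩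
  obtain rfl | hk := eq_or_ne k 0
  · simpa using hvor f' (hFS f'.2)
  · have hsep := sub_lt_dist_add_latticeVector hL (hF hf) (hF f'.2) hk.symm
    rw [map_zero, add_zero] at hsep
    have htri := dist_triangle_left f (f' + latticeVector L k) (f + z)
    rw [dist_self_add_left] at htri ⊢
    linarith

end Periodization

section Regularization

variable {n : ℕ} {σ : ℝ≥0} {S : Set (EuclideanSpace ℝ (Fin n))}

theorem avgErrorProb_periodization_inter_cube_le (σ : ℝ≥0) (hS : IsIC S) {a L : ℝ}
    (h0 : (S ∩ cube n a).Nonempty) (hL : 0 < L) (haL : a ≤ L) :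
    avgErrorProb σ (periodization L (S ∩ cube n a)) ≤
      cubeAverage S a (errorProb σ S) + noise n σ (Metric.closedBall 0 ((L - a) / 2))ᶜ := by
  have hF : S ∩ cube n a ⊆ cube n L := fun x hx i => (hx.2 i).trans_le (by linarith)
  rw [avgErrorProb_periodization σ hL (hS.2 a) h0 hF]
  exact cubeAverage_le_add fun s hs =>
    errorProb_periodization_le σ hL.le inter_subset_left inter_subset_right hs

theorem exists_isRegular_density_ge_avgErrorProb_le (hn : 0 < n) (hσ : 0 < σ) (hS : IsIC S)
    (h0 : 0 < density S) (ht : density S < ∞) {ξ : ℝ} (hξ : 0 < ξ) :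
    ∃ S' : Set (EuclideanSpace ℝ (Fin n)), IsRegular S' ∧
      density S / ENNReal.ofReal (1 + ξ) ≤ density S' ∧
      avgErrorProb σ S' ≤ avgErrorProb σ S * ENNReal.ofReal (1 + ξ) := by
  have hc : 1 < ENNReal.ofReal (1 + ξ) := by simpa using hξ
  have hdensity : density S / ENNReal.ofReal (1 + ξ) < density S := by
    simpa using ENNReal.div_lt_div_left h0.ne' ht.ne hc
  have hpos : 0 < avgErrorProb σ S :=
    (SPB_pos hn hσ (ENNReal.inv_ne_top.2 h0.ne')).trans_le
      (SPB_inv_density_le_avgErrorProb hn hσ hS)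
  have herror : avgErrorProb σ S < avgErrorProb σ S * ENNReal.ofReal (1 + ξ) := by
    simpa using ENNReal.mul_lt_mul_right hpos.ne'
      ((avgErrorProb_le_one σ S).trans_lt ENNReal.one_lt_top).ne hc
  obtain ⟨r, htail, hr⟩ : ∃ r : ℝ, avgErrorProb σ S + noise n σ (Metric.closedBall 0 r)ᶜ <
      avgErrorProb σ S * ENNReal.ofReal (1 + ξ) ∧ 0 < r := by
    have hlim := (tendsto_measure_compl_closedBall (noise n σ) 0).const_add (avgErrorProb σ S)
    rw [add_zero] at hlim
    exact ((hlim.eventually_lt_const herror).and (eventually_gt_atTop 0)).exists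
  have haverage : ∀ᶠ a in atTop, cubeAverage S a (errorProb σ S) <
      avgErrorProb σ S * ENNReal.ofReal (1 + ξ) - noise n σ (Metric.closedBall 0 r)ᶜ :=
    eventually_lt_of_limsup_lt (lt_tsub_iff_right.2 htail) (by isBoundedDefault)
  obtain ⟨a, hcount, ha, hlt⟩ := ((frequently_mul_lt_numPoints hdensity (2 * r)).and_eventually
    ((eventually_gt_atTop 0).and haverage)).exists
  have hL : 0 < a + 2 * r := by positivity
  have hF : S ∩ cube n a ⊆ cube n (a + 2 * r) := fun x hx i => (hx.2 i).trans (by linarith)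
  have hne : (S ∩ cube n a).Nonempty := by
    simpa [numPoints, nonempty_iff_ne_empty] using hcount.ne_bot
  refine ⟨periodization (a + 2 * r) (S ∩ cube n a), isRegular_periodization hL (hS.2 a) hne hF,
    ?_, ?_⟩
  · rw [density_periodization hL (hS.2 a) hF]
    exact (ENNReal.le_div_iff_mul_le (by simp [hL]) (by simp)).2 hcount.le
  · refine (avgErrorProb_periodization_inter_cube_le σ hS hne hL (by linarith)).trans ?_
    rw [add_sub_cancel_left, mul_div_cancel_left₀ r two_ne_zero]
    exact (lt_tsub_iff_right.1 hlt).le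

end Regularization

end InfConst

theorem mainTheorem2 (n : ℕ) (hn : 0 < n) (σ : ℝ≥0) (hσ : 0 < σ) :
    -- the sphere bound for arbitrary infinite constellations
    (∀ S : Set (EuclideanSpace ℝ (Fin n)), InfConst.IsIC S →
      InfConst.SPB n σ (InfConst.density S)⁻¹ ≤ InfConst.avgErrorProb σ S ∧
      (0 < InfConst.density S → InfConst.density S < ⊤ →
        InfConst.SPB n σ (InfConst.density S)⁻¹ =
          InfConst.sphereBound n σ (InfConst.nld S))) ∧
    -- the average Voronoi cell volume of a regular constellation
    (∀ S : Set (EuclideanSpace ℝ (Fin n)), InfConst.IsRegular S →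
      InfConst.density S = (InfConst.avgVoronoiVol S)⁻¹) ∧
    -- convexity of the sphere bound in the volume
    ConvexOn ℝ (Set.Ici 0) (fun v : ℝ => (InfConst.SPB n σ (ENNReal.ofReal v)).toReal) ∧
    -- the sphere bound for regular constellations
    (∀ S : Set (EuclideanSpace ℝ (Fin n)), InfConst.IsRegular S →
      InfConst.SPB n σ (InfConst.avgVoronoiVol S) ≤ InfConst.avgErrorProb σ S ∧
      InfConst.SPB n σ (InfConst.avgVoronoiVol S) =
        InfConst.SPB n σ (InfConst.density S)⁻¹) ∧
    -- regularization
    (∀ S : Set (EuclideanSpace ℝ (Fin n)), InfConst.IsIC S →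
      0 < InfConst.density S → InfConst.density S < ⊤ →
      ∀ ξ : ℝ, 0 < ξ → ∃ S' : Set (EuclideanSpace ℝ (Fin n)), InfConst.IsRegular S' ∧
        InfConst.density S / ENNReal.ofReal (1 + ξ) ≤ InfConst.density S' ∧
        InfConst.avgErrorProb σ S' ≤ InfConst.avgErrorProb σ S * ENNReal.ofReal (1 + ξ)) := by
  refine ⟨fun S hS => ⟨InfConst.SPB_inv_density_le_avgErrorProb hn hσ hS,
    InfConst.SPB_inv_density_eq_sphereBound σ⟩, fun S hS => ?_, InfConst.convexOn_SPB hn hσ,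
    fun S hS => ?_, fun S hS h0 ht ξ hξ =>
      InfConst.exists_isRegular_density_ge_avgErrorProb_le hn hσ hS h0 ht hξ⟩
  · rw [hS.avgVoronoiVol_eq, inv_inv]
  · rw [hS.avgVoronoiVol_eq]
    exact ⟨InfConst.SPB_inv_density_le_avgErrorProb hn hσ hS.1, rfl⟩
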